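/- Let Alice hold $\mathbb{C}^6$ with orthonormal basis $|0\rangle,\dots,|5\rangle$, Bob-1 hold $\mathbb{C}^5$ with orthonormal basis $|0\rangle,\dots,|4\rangle$, and Bob-2 hold $\mathbb{C}^5$ with orthonormal basis $|1\rangle,\dots,|5\rangle$. Put $$|\alpha_\pm\rangle=\tfrac{1}{\sqrt2}(|1\rangle\pm|2\rangle),\quad |\beta_\pm\rangle=\tfrac{1}{\sqrt2}(|2\rangle\pm|3\rangle),\quad |\gamma_\pm\rangle=\tfrac{1}{\sqrt2}(|2\rangle\pm|4\rangle),$$ and for $i,j,k\in\{0,1\}$ with $i+j+k$ even let $|\Psi_{ijk}\rangle$, $|\Phi_{ijk}\rangle$, $|\Upsilon_{ijk}\rangle$ be the vectors $$\tfrac12\left(|a\rangle+(-1)^i|b\rangle+(-1)^j|c\rangle+(-1)^k|d\rangle\right)$$ with $(a,b,c,d)=(0,1,2,3)$, $(1,2,3,4)$ and $(1,2,4,5)$, respectively. Let $\Sigma\subset\mathbb{C}^6\otimes\mathbb{C}^5\otimes\mathbb{C}^5$ be the set of the $42$ states (tensor factors in the order Alice, Bob-1, Bob-2) $$\begin{aligned}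 &|1\rangle|\alpha_\pm\rangle|4\rangle,\ |\alpha_\pm\rangle|3\rangle|4\rangle,\ |3\rangle|\beta_\pm\rangle|4\rangle,\ |\beta_\pm\rangle|1\rangle|4\rangle,\ |4\rangle|3\rangle|\gamma_\pm\rangle,\ |\gamma_\pm\rangle|3\rangle|1\rangle,\ |1\rangle|3\rangle|\alpha_\pm\rangle,\\ &|0\rangle|\Psi_{ijk}\rangle|3\rangle,\ |\Psi_{ijk}\rangle|4\rangle|3\rangle,\ |4\rangle|\Phi_{ijk}\rangle|3\rangle,\ |\Phi_{ijk}\rangle|0\rangle|3\rangle,\ |5\rangle|0\rangle|\Phi_{ijk}\rangle,\ |\Upsilon_{ijk}\rangle|0\rangle|5\rangle,\ |3\rangle|0\rangle|\Upsilon_{ijk}\rangle . \end{aligned}$$ Then $\Sigma$ is a genuinely nonlocal set of product states: its elements are pairwise orthogonal, fully product unit vectors, and for every bipartition of the three parties into two non-empty groups (each group acting jointly as one party), the states of $\Sigma$ cannot be perfectly distinguished by local operations and classical communication (LOCC) between the two groups. Here an LOCC protocol may have any number of rounds, possibly infinitely many, each round consisting of a local measurement with finitely many outcomes (local ancillas allowed)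 whose outcome is announced; perfect distinguishability means that for some protocol and some rule for guessing the state from the announced outcomes, for every state of $\Sigma$ the probability that the guess after $n$ rounds is correct tends to $1$ as $n\to\infty$ (for a protocol with finitely many rounds: the final guess is correct with probability $1$). -/

import Mathlib

noncomputable section

/-- State vectors of a composite system: party `p` holds `ℂ^(σ p)` with orthonormal basis `σ p`,
and the tensor product `⨂ p, ℂ^(σ p)` has the orthonormal basis `∀ p, σ p`. -/
abbrev StateVec {P : Type} (σ : P → Type) [Fintype (∀ p, σ p)] : Type :=
  EuclideanSpace ℂ (∀ p, σ p)

/-- The product vector `⨂ p, φ p`. -/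
def productVec {P : Type} [Fintype P] {σ : P → Type} [Fintype (∀ p, σ p)]
    (φ : ∀ p, EuclideanSpace ℂ (σ p)) : StateVec σ :=
  WithLp.toLp 2 fun i => ∏ p, φ p (i p)

/-- The action of the local operators `⨂ p, A p` on a state vector. -/
def applyLocal {P : Type} [Fintype P] {σ τ : P → Type}
    [Fintype (∀ p, σ p)] [Fintype (∀ p, τ p)]
    (A : ∀ p, Matrix (τ p) (σ p) ℂ) (ψ : StateVec σ) : StateVec τ :=
  WithLp.toLp 2 fun j => ∑ i, (∏ p, A p (j p) (i p)) * ψ i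

/-- An LOCC protocol with no bound on the number of rounds. The classical record `h` is the list
of all outcomes announced so far, the most recent one first. First every party may attach an
ancilla (a local isometry). In each round, depending on the record, one party (`actor h`) performs
a local measurement with finitely many outcomes `o < outcomes h` and Kraus operators
`kraus (actor h) h o` and announces the outcome; each other party may then apply a local isometry
that depends on the record. The local dimensions may change from round to round, so that ancillas
can be added or discarded at any time. A protocol with finitely many rounds is one in which,
from some round on, all local operations are trivial. -/
structure LOCCProtocol (P : Type) (σ : P → Type) [∀ p, Fintype (σ p)]
    [∀ p, DecidableEq (σ p)] where
  /-- the dimension of the system of each party after a given record -/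
  dim : P → List ℕ → ℕ
  prep : ∀ p, Matrix (Fin (dim p [])) (σ p) ℂ
  prep_isometry : ∀ p, (prep p).conjTranspose * prep p = 1
  actor : List ℕ → P
  outcomes : List ℕ → ℕ
  kraus : ∀ (p : P) (h : List ℕ) (o : ℕ), Matrix (Fin (dim p (o :: h))) (Fin (dim p h)) ℂ
  kraus_complete : ∀ h, ∑ o ∈ Finset.range (outcomes h),
    (kraus (actor h) h o).conjTranspose * kraus (actor h) h o = 1
  kraus_isometry : ∀ h, ∀ o < outcomes h, ∀ p ≠ actor h,
    (kraus p h o).conjTranspose * kraus p h o = 1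

namespace LOCCProtocol

variable {P : Type} {σ : P → Type} [∀ p, Fintype (σ p)] [∀ p, DecidableEq (σ p)]

/-- The composition of all the operators that party `p` has applied when the record is `h`. -/
def accumulated (π : LOCCProtocol P σ) (p : P) :
    (h : List ℕ) → Matrix (Fin (π.dim p h)) (σ p) ℂ
  | [] => π.prep p
  | o :: h => π.kraus p h o * π.accumulated p h

/-- The records that are possible after `n` rounds. -/
def records (π : LOCCProtocol P σ) : ℕ → Finset (List ℕ)
  | 0 => {[]}
  | n + 1 => (π.records n).biUnion fun h =>
      (Finset.range (π.outcomes h)).image fun o => o :: h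

variable [Fintype P] [DecidableEq P]

/-- The probability of the record `h` when the system is initially in the state `ψ`. -/
def recordProb (π : LOCCProtocol P σ) (ψ : StateVec σ) (h : List ℕ) : ℝ :=
  ‖applyLocal (fun p => π.accumulated p h) ψ‖ ^ 2

open Classical in
/-- The probability that after `n` rounds the guess based on the record is right, if the state of
the system is initially `ψ`. -/
def successProb (π : LOCCProtocol P σ) (guess : List ℕ → StateVec σ) (n : ℕ)
    (ψ : StateVec σ) : ℝ :=
  ∑ h ∈ (π.records n).filter (fun h => guess h = ψ), π.recordProb ψ h

end LOCCProtocol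

/-- A set of states is perfectly distinguishable by LOCC if there are an LOCC protocol and a rule
that guesses the state from the record such that, for each state of the set, the probability
of a right guess after `n` rounds tends to `1` as `n` grows. For a protocol with finitely many
rounds this says that the final guess is right with probability `1`. -/
def LOCCDistinguishable {P : Type} [Fintype P] [DecidableEq P] {σ : P → Type}
    [∀ p, Fintype (σ p)] [∀ p, DecidableEq (σ p)] (S : Set (StateVec σ)) : Prop :=
  ∃ (π : LOCCProtocol P σ) (guess : List ℕ → StateVec σ), ∀ ψ ∈ S,
    Filter.Tendsto (fun n => π.successProb guess n ψ) Filter.atTop (nhds 1)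

/-- The same state when, for each `q`, the parties `i` with `f i = q` have come together
and act as one party `q`, which holds `⨂ i with f i = q, ℂ^(σ i)`. -/
def groupParties {P Q : Type} [Fintype P] [DecidableEq P] [Fintype Q] [DecidableEq Q]
    {σ : P → Type} [∀ p, Fintype (σ p)] (f : P → Q) (ψ : StateVec σ) :
    StateVec fun q : Q => ∀ i : {i : P // f i = q}, σ i :=
  WithLp.toLp 2 fun x => ψ fun i => x (f i) ⟨i, rfl⟩

/-- A genuinely nonlocal set of product states: a set of pairwise orthogonal, fully product
(normalized) states that cannot be perfectly distinguished by LOCC across any bipartition of the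
parties into two non-empty groups. -/
structure IsGNPS {P : Type} [Fintype P] [DecidableEq P] {σ : P → Type}
    [∀ p, Fintype (σ p)] [∀ p, DecidableEq (σ p)] (S : Set (StateVec σ)) : Prop where
  normalized : ∀ ψ ∈ S, ‖ψ‖ = 1
  product : ∀ ψ ∈ S, ∃ φ : ∀ p, EuclideanSpace ℂ (σ p), ψ = productVec φ
  orthogonal : S.Pairwise fun ψ φ => inner ℂ ψ φ = 0
  nonlocal : ∀ f : P → Bool, Function.Surjective f →
    ¬ LOCCDistinguishable (groupParties f '' S)

namespace SigmaStates

/-- The local dimensions of Alice (party `0`), Bob-1 (party `1`) and Bob-2 (party `2`). -/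
def dims : Fin 3 → ℕ := ![6, 5, 5]

/-- The basis vectors are labelled `0, …, 5` for Alice, `0, …, 4` for Bob-1
and `1, …, 5` for Bob-2; this is the first label of each party. -/
def firstLabel : Fin 3 → ℕ := ![0, 0, 1]

/-- A recipe for a local vector, to be used at any of the three parties. -/
abbrev LocalVec : Type := ∀ p : Fin 3, EuclideanSpace ℂ (Fin (dims p))

/-- The basis vector with label `l`. -/
def ket (l : ℕ) : LocalVec := fun p =>
  WithLp.toLp 2 fun i => if firstLabel p + (i : ℕ) = l then 1 else 0

/-- The vectors `(|a⟩ + (-1)^s |b⟩) / √2`. -/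
def pair (a b : ℕ) (s : Fin 2) : LocalVec := fun p =>
  ((1 / Real.sqrt 2 : ℝ) : ℂ) • (ket a p + (-1 : ℂ) ^ (s : ℕ) • ket b p)

/-- The vectors `(|a⟩ + (-1)^i |b⟩ + (-1)^j |c⟩ + (-1)^k |d⟩) / 2`. -/
def quad (a b c d : ℕ) (i j k : Fin 2) : LocalVec := fun p =>
  (1 / 2 : ℂ) • (ket a p + (-1 : ℂ) ^ (i : ℕ) • ket b p + (-1 : ℂ) ^ (j : ℕ) • ket c p
    + (-1 : ℂ) ^ (k : ℕ) • ket d p)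

/-- The product state `|a⟩_A ⊗ |b⟩_{B₁} ⊗ |c⟩_{B₂}`. -/
def tri (a b c : LocalVec) : StateVec fun p : Fin 3 => Fin (dims p) :=
  productVec fun p => (![a, b, c] : Fin 3 → LocalVec) p p

def alpha : Fin 2 → LocalVec := pair 1 2
def beta : Fin 2 → LocalVec := pair 2 3
def gamma : Fin 2 → LocalVec := pair 2 4
def Psi : Fin 2 → Fin 2 → Fin 2 → LocalVec := quad 0 1 2 3
def Phi : Fin 2 → Fin 2 → Fin 2 → LocalVec := quad 1 2 3 4
def Upsilon : Fin 2 → Fin 2 → Fin 2 → LocalVec := quad 1 2 4 5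

/-- The set `Σ` of `7 * 2 + 7 * 4` states in `ℂ⁶ ⊗ ℂ⁵ ⊗ ℂ⁵`. The sum `i + j + k` in `Fin 2`
is the sum modulo `2`. -/
def SigmaSet : Set (StateVec fun p : Fin 3 => Fin (dims p)) :=
  {ψ | (∃ s : Fin 2,
      ψ = tri (ket 1) (alpha s) (ket 4) ∨
      ψ = tri (alpha s) (ket 3) (ket 4) ∨
      ψ = tri (ket 3) (beta s) (ket 4) ∨
      ψ = tri (beta s) (ket 1) (ket 4) ∨
      ψ = tri (ket 4) (ket 3) (gamma s) ∨
      ψ = tri (gamma s) (ket 3) (ket 1) ∨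
      ψ = tri (ket 1) (ket 3) (alpha s)) ∨
    (∃ i j k : Fin 2, i + j + k = 0 ∧
     (ψ = tri (ket 0) (Psi i j k) (ket 3) ∨
      ψ = tri (Psi i j k) (ket 4) (ket 3) ∨
      ψ = tri (ket 4) (Phi i j k) (ket 3) ∨
      ψ = tri (Phi i j k) (ket 0) (ket 3) ∨
      ψ = tri (ket 5) (ket 0) (Phi i j k) ∨
      ψ = tri (Upsilon i j k) (ket 0) (ket 5) ∨
      ψ = tri (ket 3) (ket 0) (Upsilon i j k)))}

end SigmaStates

end

/-!
Call a family of product states locally stable if a one-party operator that keeps it orthogonal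
must be a scalar. Such a family is LOCC-indistinguishable, even with infinitely many rounds. Give
every effect `⨂ p, E p` of a protocol a potential: the total overlap it creates between the states
or, while all `E p` are nearly scalar, a small multiple of the product of these scalars if that is
larger. A measurement splits one factor, so by stability it cannot leave the nearly scalar
operators without creating an overlap proportional to the scalars: the potential is subadditive,
and its sum over the records never falls below its positive initial value. Under perfect
discrimination, however, Cauchy–Schwarz makes this sum tend to zero.

In a bipartition, Alice's group does not contain both Bobs. With either Bob, Alice shares eight
domino states, a locally stable family, while the third party is a spectator in a fixed state.
-/

open Matrix Filter Topology Function
open scoped Matrix.Norms.L2Operator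

noncomputable section

section ProductVectors

variable {P : Type} [Fintype P] [DecidableEq P] {σ τ υ : P → Type} [∀ p, Fintype (σ p)]
  [∀ p, Fintype (τ p)] [∀ p, Fintype (υ p)]

theorem inner_productVec (φ χ : ∀ p, EuclideanSpace ℂ (σ p)) :
    inner ℂ (productVec φ) (productVec χ) = ∏ p, inner ℂ (φ p) (χ p) := by
  simp only [productVec, PiLp.inner_apply, RCLike.inner_apply]
  rw [Finset.prod_univ_sum, Fintype.piFinset_univ]
  simp only [map_prod, Finset.prod_mul_distrib]

theorem norm_productVec_eq_one {φ : ∀ p, EuclideanSpace ℂ (σ p)} (hφ : ∀ p, ‖φ p‖ = 1) :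
    ‖productVec φ‖ = 1 := by
  rw [norm_eq_sqrt_re_inner (𝕜 := ℂ), inner_productVec,
    Finset.prod_eq_one fun p _ => inner_self_eq_one_of_norm_eq_one (hφ p), RCLike.one_re,
    Real.sqrt_one]

theorem productVec_update_sum_smul {κ : Type} [Fintype κ] (φ : ∀ p, EuclideanSpace ℂ (σ p))
    (p : P) (c : κ → ℂ) (v : κ → EuclideanSpace ℂ (σ p)) :
    productVec (update φ p (∑ k, c k • v k)) = ∑ k, c k • productVec (update φ p (v k)) := by
  have eval (w : EuclideanSpace ℂ (σ p)) (x : ∀ p, σ p) :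
      productVec (update φ p w) x = w (x p) * ∏ q ∈ Finset.univ.erase p, φ q (x q) := by
    change ∏ q, update φ p w q (x q) = _
    rw [← Finset.mul_prod_erase _ _ (Finset.mem_univ p), update_self]
    congr 1
    exact Finset.prod_congr rfl fun q hq => by rw [update_of_ne (Finset.ne_of_mem_erase hq)]
  ext x
  simp [eval, Finset.sum_mul, mul_assoc]

theorem applyLocal_productVec [∀ p, DecidableEq (σ p)] (A : ∀ p, Matrix (τ p) (σ p) ℂ)
    (φ : ∀ p, EuclideanSpace ℂ (σ p)) :
    applyLocal A (productVec φ) = productVec fun p => toEuclideanLin (A p) (φ p) := by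
  ext j
  simp only [applyLocal, productVec, toLpLin_apply, mulVec, dotProduct]
  rw [Finset.prod_univ_sum, Fintype.piFinset_univ]
  simp only [Finset.prod_mul_distrib]

theorem inner_productVec_applyLocal [∀ p, DecidableEq (σ p)] (G : ∀ p, Matrix (σ p) (σ p) ℂ)
    (φ χ : ∀ p, EuclideanSpace ℂ (σ p)) :
    inner ℂ (productVec φ) (applyLocal G (productVec χ))
      = ∏ p, inner ℂ (φ p) (toEuclideanLin (G p) (χ p)) := by
  rw [applyLocal_productVec, inner_productVec]

theorem applyLocal_one [∀ p, DecidableEq (σ p)] (ψ : StateVec σ) :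
    applyLocal (1 : ∀ p, Matrix (σ p) (σ p) ℂ) ψ = ψ := by
  ext j
  have (i : ∀ p, σ p) :
      ∏ p, (1 : Matrix (σ p) (σ p) ℂ) (j p) (i p) = if j = i then 1 else 0 := by
    simp only [one_apply, Finset.prod_ite_zero, Finset.prod_const_one,
      Finset.mem_univ, true_imp_iff, funext_iff]
  simp [applyLocal, this]

theorem applyLocal_applyLocal (A : ∀ p, Matrix (υ p) (τ p) ℂ) (B : ∀ p, Matrix (τ p) (σ p) ℂ)
    (ψ : StateVec σ) : applyLocal A (applyLocal B ψ) = applyLocal (fun p => A p * B p) ψ := by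
  ext k
  simp only [applyLocal, mul_apply, Finset.mul_sum]
  rw [Finset.sum_comm]
  refine Finset.sum_congr rfl fun i _ => ?_
  rw [Finset.prod_univ_sum, Fintype.piFinset_univ, Finset.sum_mul]
  simp only [Finset.prod_mul_distrib, mul_assoc]

theorem applyLocal_conjTranspose_applyLocal [∀ p, DecidableEq (σ p)]
    {V : ∀ p, Matrix (τ p) (σ p) ℂ} (hV : ∀ p, (V p)ᴴ * V p = 1) (ψ : StateVec σ) :
    applyLocal (fun p => (V p)ᴴ) (applyLocal V ψ) = ψ := by
  rw [applyLocal_applyLocal, funext hV]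
  exact applyLocal_one ψ

theorem inner_applyLocal_left (A : ∀ p, Matrix (τ p) (σ p) ℂ) (ψ : StateVec σ)
    (φ : StateVec τ) :
    inner ℂ (applyLocal A ψ) φ = inner ℂ ψ (applyLocal (fun p => (A p)ᴴ) φ) := by
  simp only [applyLocal, PiLp.inner_apply, RCLike.inner_apply, map_sum, map_mul, map_prod,
    Finset.mul_sum, Finset.sum_mul, conjTranspose_apply, RCLike.star_def]
  rw [Finset.sum_comm]
  exact Finset.sum_congr rfl fun i _ => Finset.sum_congr rfl fun j _ => by ring

theorem inner_applyLocal_applyLocal (A : ∀ p, Matrix (τ p) (σ p) ℂ) (ψ φ : StateVec σ) :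
    inner ℂ (applyLocal A ψ) (applyLocal A φ)
      = inner ℂ ψ (applyLocal (fun p => (A p)ᴴ * A p) φ) := by
  rw [inner_applyLocal_left, applyLocal_applyLocal]

theorem applyLocal_update_sum {α : Type} (A : ∀ p, Matrix (τ p) (σ p) ℂ) (p : P)
    (s : Finset α) (B : α → Matrix (τ p) (σ p) ℂ) (ψ : StateVec σ) :
    applyLocal (update A p (∑ o ∈ s, B o)) ψ = ∑ o ∈ s, applyLocal (update A p (B o)) ψ := by
  have entry (M : Matrix (τ p) (σ p) ℂ) (j : ∀ p, τ p) (i : ∀ p, σ p) :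
      ∏ q, update A p M q (j q) (i q)
        = M (j p) (i p) * ∏ q ∈ Finset.univ.erase p, A q (j q) (i q) := by
    rw [← Finset.mul_prod_erase _ _ (Finset.mem_univ p), update_self]
    congr 1
    exact Finset.prod_congr rfl fun q hq => by rw [update_of_ne (Finset.ne_of_mem_erase hq)]
  ext j
  simp only [applyLocal, WithLp.ofLp_sum, Finset.sum_apply, entry, Matrix.sum_apply,
    Finset.sum_mul]
  exact Finset.sum_comm

end ProductVectors

namespace LOCCProtocol

variable {P : Type} {σ : P → Type} [∀ p, Fintype (σ p)] [∀ p, DecidableEq (σ p)]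

theorem sum_records_succ {M : Type} [AddCommMonoid M] (π : LOCCProtocol P σ) (n : ℕ)
    (g : List ℕ → M) :
    ∑ h ∈ π.records (n + 1), g h
      = ∑ h ∈ π.records n, ∑ o ∈ Finset.range (π.outcomes h), g (o :: h) := by
  rw [records, Finset.sum_biUnion]
  · exact Finset.sum_congr rfl fun h _ => Finset.sum_image fun _ _ _ _ h => (List.cons.inj h).1
  · intro h _ h' _ hne
    simp only [onFun, Finset.disjoint_left, Finset.mem_image]
    rintro _ ⟨o, _, rfl⟩ ⟨o', _, he⟩
    exact hne (List.cons.inj he).2.symm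

/-- The local factors of the POVM element of the record `h`: the state `ψ` produces this record
with probability `⟨ψ, (⨂ p, effect h p) ψ⟩`. -/
def effect (π : LOCCProtocol P σ) (h : List ℕ) (p : P) : Matrix (σ p) (σ p) ℂ :=
  (π.accumulated p h)ᴴ * π.accumulated p h

theorem effect_nil (π : LOCCProtocol P σ) : π.effect [] = 1 :=
  funext π.prep_isometry

theorem effect_cons (π : LOCCProtocol P σ) (h : List ℕ) (o : ℕ) (p : P) :
    π.effect (o :: h) p
      = (π.accumulated p h)ᴴ * ((π.kraus p h o)ᴴ * π.kraus p h o) * π.accumulated p h := by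
  simp only [effect, accumulated, conjTranspose_mul, Matrix.mul_assoc]

theorem sum_effect_cons_actor (π : LOCCProtocol P σ) (h : List ℕ) :
    ∑ o ∈ Finset.range (π.outcomes h), π.effect (o :: h) (π.actor h)
      = π.effect h (π.actor h) := by
  simp only [effect_cons]
  rw [← Matrix.sum_mul, ← Matrix.mul_sum, π.kraus_complete, Matrix.mul_one, effect]

theorem effect_cons_of_ne_actor (π : LOCCProtocol P σ) {h : List ℕ} {o : ℕ}
    (ho : o < π.outcomes h) {p : P} (hp : p ≠ π.actor h) :
    π.effect (o :: h) p = π.effect h p := by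
  rw [effect_cons, π.kraus_isometry h o ho p hp, Matrix.mul_one, effect]

variable [DecidableEq P]

theorem effect_cons_eq_update (π : LOCCProtocol P σ) {h : List ℕ} {o : ℕ}
    (ho : o < π.outcomes h) :
    π.effect (o :: h) = update (π.effect h) (π.actor h) (π.effect (o :: h) (π.actor h)) :=
  eq_update_iff.2 ⟨rfl, fun _ hp => π.effect_cons_of_ne_actor ho hp⟩

/-- A round splits a single local factor of an effect into a sum, so a function that is
subadditive in every factor can only grow, in total, from round to round. -/
theorem le_sum_records_of_subadditive (π : LOCCProtocol P σ)
    {Φ : (∀ p, Matrix (σ p) (σ p) ℂ) → ℝ}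
    (hΦ : ∀ E p (s : Finset ℕ) (F : ℕ → Matrix (σ p) (σ p) ℂ),
      Φ (update E p (∑ o ∈ s, F o)) ≤ ∑ o ∈ s, Φ (update E p (F o))) (n : ℕ) :
    Φ 1 ≤ ∑ h ∈ π.records n, Φ (π.effect h) := by
  induction n with
  | zero => simp [records, effect_nil]
  | succ n ih =>
    rw [sum_records_succ]
    refine ih.trans (Finset.sum_le_sum fun h _ => ?_)
    calc Φ (π.effect h)
        = Φ (update (π.effect h) (π.actor h)
            (∑ o ∈ Finset.range (π.outcomes h), π.effect (o :: h) (π.actor h))) := by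
          rw [sum_effect_cons_actor, update_eq_self]
      _ ≤ ∑ o ∈ Finset.range (π.outcomes h),
            Φ (update (π.effect h) (π.actor h) (π.effect (o :: h) (π.actor h))) := hΦ ..
      _ = ∑ o ∈ Finset.range (π.outcomes h), Φ (π.effect (o :: h)) :=
          Finset.sum_congr rfl fun o ho => by
            rw [← π.effect_cons_eq_update (Finset.mem_range.1 ho)]

variable [Fintype P]

theorem recordProb_eq_re_inner (π : LOCCProtocol P σ) (ψ : StateVec σ) (h : List ℕ) :
    π.recordProb ψ h = (inner ℂ ψ (applyLocal (π.effect h) ψ)).re := by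
  rw [recordProb, norm_sq_eq_re_inner (𝕜 := ℂ), inner_applyLocal_applyLocal]
  rfl

theorem recordProb_nonneg (π : LOCCProtocol P σ) (ψ : StateVec σ) (h : List ℕ) :
    0 ≤ π.recordProb ψ h :=
  sq_nonneg _

theorem sum_recordProb (π : LOCCProtocol P σ) (ψ : StateVec σ) (n : ℕ) :
    ∑ h ∈ π.records n, π.recordProb ψ h = ‖ψ‖ ^ 2 := by
  have additive (E : ∀ p, Matrix (σ p) (σ p) ℂ) (p : P) (s : Finset ℕ)
      (F : ℕ → Matrix (σ p) (σ p) ℂ) :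
      (inner ℂ ψ (applyLocal (update E p (∑ o ∈ s, F o)) ψ)).re
        = ∑ o ∈ s, (inner ℂ ψ (applyLocal (update E p (F o)) ψ)).re := by
    rw [applyLocal_update_sum, inner_sum, Complex.re_sum]
  have le := π.le_sum_records_of_subadditive
    (Φ := fun E => (inner ℂ ψ (applyLocal E ψ)).re) (fun E p s F => (additive E p s F).le) n
  have ge := π.le_sum_records_of_subadditive
    (Φ := fun E => -(inner ℂ ψ (applyLocal E ψ)).re)
    (fun E p s F => by rw [additive, Finset.sum_neg_distrib]) n
  simp only [applyLocal_one, ← recordProb_eq_re_inner, Finset.sum_neg_distrib] at le ge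
  rw [norm_sq_eq_re_inner (𝕜 := ℂ)]
  exact le_antisymm (neg_le_neg_iff.1 ge) le

theorem norm_inner_applyLocal_effect_le (π : LOCCProtocol P σ) (ψ φ : StateVec σ)
    (h : List ℕ) :
    ‖inner ℂ ψ (applyLocal (π.effect h) φ)‖ ≤ √(π.recordProb ψ h) * √(π.recordProb φ h) := by
  rw [recordProb, recordProb, Real.sqrt_sq (norm_nonneg _), Real.sqrt_sq (norm_nonneg _)]
  exact (congrArg norm (inner_applyLocal_applyLocal _ ψ φ)).symm.trans_le
    (norm_inner_le_norm _ _)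

/-- The Bhattacharyya coefficient of the distributions of the records after `n` rounds. -/
def affinity (π : LOCCProtocol P σ) (ψ φ : StateVec σ) (n : ℕ) : ℝ :=
  ∑ h ∈ π.records n, √(π.recordProb ψ h) * √(π.recordProb φ h)

theorem successProb_le_one (π : LOCCProtocol P σ) (guess : List ℕ → StateVec σ) (n : ℕ)
    {ψ : StateVec σ} (hψ : ‖ψ‖ = 1) : π.successProb guess n ψ ≤ 1 := by
  classical
  calc π.successProb guess n ψ ≤ ∑ h ∈ π.records n, π.recordProb ψ h :=
        Finset.sum_le_sum_of_subset_of_nonneg (Finset.filter_subset _ _)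
          fun h _ _ => π.recordProb_nonneg ψ h
    _ = 1 := by rw [sum_recordProb, hψ, one_pow]

open Classical in
theorem sum_recordProb_guess_ne (π : LOCCProtocol P σ) (guess : List ℕ → StateVec σ) (n : ℕ)
    {ψ : StateVec σ} (hψ : ‖ψ‖ = 1) :
    ∑ h ∈ π.records n with guess h ≠ ψ, π.recordProb ψ h = 1 - π.successProb guess n ψ := by
  rw [successProb, eq_sub_iff_add_eq', Finset.sum_filter_add_sum_filter_not, sum_recordProb, hψ,
    one_pow]

open Classical in
theorem sum_sqrt_guess_ne_le (π : LOCCProtocol P σ) (guess : List ℕ → StateVec σ) (n : ℕ)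
    {ψ φ : StateVec σ} (hψ : ‖ψ‖ = 1) (hφ : ‖φ‖ = 1) :
    ∑ h ∈ π.records n with guess h ≠ ψ, √(π.recordProb ψ h) * √(π.recordProb φ h)
      ≤ √(1 - π.successProb guess n ψ) := by
  refine (Real.sum_sqrt_mul_sqrt_le _ (π.recordProb_nonneg ψ) (π.recordProb_nonneg φ)).trans ?_
  rw [sum_recordProb_guess_ne π guess n hψ]
  refine mul_le_of_le_one_right (Real.sqrt_nonneg _) (Real.sqrt_le_one.2 ?_)
  calc ∑ h ∈ π.records n with guess h ≠ ψ, π.recordProb φ h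
      ≤ ∑ h ∈ π.records n, π.recordProb φ h :=
        Finset.sum_le_sum_of_subset_of_nonneg (Finset.filter_subset _ _)
          fun h _ _ => π.recordProb_nonneg φ h
    _ = 1 := by rw [sum_recordProb, hφ, one_pow]

theorem affinity_le (π : LOCCProtocol P σ) (guess : List ℕ → StateVec σ) (n : ℕ)
    {ψ φ : StateVec σ} (hψ : ‖ψ‖ = 1) (hφ : ‖φ‖ = 1) (hne : ψ ≠ φ) :
    π.affinity ψ φ n
      ≤ √(1 - π.successProb guess n ψ) + √(1 - π.successProb guess n φ) := by
  classical
  set g := fun h => √(π.recordProb ψ h) * √(π.recordProb φ h)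
  have g_nonneg h : 0 ≤ g h := by positivity
  have wrong_φ : ∑ h ∈ π.records n with guess h ≠ φ, g h ≤ √(1 - π.successProb guess n φ) := by
    simpa only [g, mul_comm] using π.sum_sqrt_guess_ne_le guess n hφ hψ
  refine le_trans ?_ (add_le_add (π.sum_sqrt_guess_ne_le guess n hψ hφ) wrong_φ)
  rw [← Finset.sum_union_inter]
  refine (Finset.sum_le_sum_of_subset_of_nonneg (fun h hh => ?_) fun h _ _ => g_nonneg h).trans
    (le_add_of_nonneg_right (Finset.sum_nonneg fun h _ => g_nonneg h))
  rw [← Finset.filter_or, Finset.mem_filter]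
  refine ⟨hh, or_iff_not_imp_left.2 fun h_eq => ?_⟩
  rwa [not_not.1 h_eq]

theorem tendsto_affinity {π : LOCCProtocol P σ} {guess : List ℕ → StateVec σ}
    {ψ φ : StateVec σ} (hψ : ‖ψ‖ = 1) (hφ : ‖φ‖ = 1) (hne : ψ ≠ φ)
    (tψ : Tendsto (fun n => π.successProb guess n ψ) atTop (𝓝 1))
    (tφ : Tendsto (fun n => π.successProb guess n φ) atTop (𝓝 1)) :
    Tendsto (π.affinity ψ φ) atTop (𝓝 0) :=
  squeeze_zero (fun n => Finset.sum_nonneg fun h _ => by positivity)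
    (fun n => π.affinity_le guess n hψ hφ hne)
    (by simpa using (tψ.const_sub 1).sqrt.add (tφ.const_sub 1).sqrt)

end LOCCProtocol

section NearScalar

variable {ι : Type} [Fintype ι]

/-- The normalized trace, a linear functional which sends the identity to `1`. -/
def normTrace : Matrix ι ι ℂ →ₗ[ℂ] ℂ :=
  (Fintype.card ι : ℂ)⁻¹ • traceLinearMap ι ℂ ℂ

variable [DecidableEq ι]

theorem normTrace_one [Nonempty ι] : normTrace (1 : Matrix ι ι ℂ) = 1 := by
  simp [normTrace]

/-- The matrix `G` is, up to a relative error `ε` in operator norm, the scalar `normTrace G`. -/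
def NearScalar (ε : ℝ) (G : Matrix ι ι ℂ) : Prop :=
  ‖G - normTrace G • 1‖ ≤ ε * ‖normTrace G‖

theorem nearScalar_one [Nonempty ι] {ε : ℝ} (hε : 0 ≤ ε) :
    NearScalar ε (1 : Matrix ι ι ℂ) := by
  simpa [NearScalar, normTrace_one] using hε

theorem norm_inner_toEuclideanLin_le (G : Matrix ι ι ℂ) {x y : EuclideanSpace ℂ ι}
    (hx : ‖x‖ = 1) (hy : ‖y‖ = 1) : ‖inner ℂ x (toEuclideanLin G y)‖ ≤ ‖G‖ := by
  calc ‖inner ℂ x (toEuclideanLin G y)‖ ≤ ‖x‖ * ‖toEuclideanLin G y‖ := norm_inner_le_norm _ _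
    _ ≤ 1 * (‖G‖ * ‖y‖) := by rw [hx]; gcongr; exact G.l2_opNorm_mulVec y
    _ = ‖G‖ := by rw [hy, one_mul, mul_one]

theorem NearScalar.half_mul_norm_inner_le {ε : ℝ} {G : Matrix ι ι ℂ} (hG : NearScalar ε G)
    {x y : EuclideanSpace ℂ ι} (hx : ‖x‖ = 1) (hy : ‖y‖ = 1)
    (hε : inner ℂ x y ≠ 0 → ε ≤ ‖inner ℂ x y‖ / 2) :
    ‖normTrace G‖ / 2 * ‖inner ℂ x y‖ ≤ ‖inner ℂ x (toEuclideanLin G y)‖ := by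
  obtain h0 | h0 := eq_or_ne (inner ℂ x y) 0
  · simp [h0]
  have error : ‖inner ℂ x (toEuclideanLin (G - normTrace G • 1) y)‖
      ≤ ‖inner ℂ x y‖ / 2 * ‖normTrace G‖ :=
    (norm_inner_toEuclideanLin_le _ hx hy).trans (hG.trans (by gcongr; exact hε h0))
  have split : inner ℂ x (toEuclideanLin (G - normTrace G • 1) y)
      = inner ℂ x (toEuclideanLin G y) - normTrace G * inner ℂ x y := by
    simp
  have := norm_sub_norm_le (normTrace G * inner ℂ x y) (inner ℂ x (toEuclideanLin G y))
  rw [norm_sub_rev, ← split, norm_mul] at this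
  linarith

end NearScalar

section ProductOperators

variable {P : Type} [Fintype P] {σ : P → Type} [∀ p, Fintype (σ p)]

/-- The size of the scalars that the factors of `⨂ p, E p` approximate. The factors `1 / 2` make it
a lower bound for the diagonal matrix elements when these approximations are good. -/
def scalarWeight (E : ∀ p, Matrix (σ p) (σ p) ℂ) : ℝ :=
  ∏ p, ‖normTrace (E p)‖ / 2

theorem scalarWeight_nonneg (E : ∀ p, Matrix (σ p) (σ p) ℂ) : 0 ≤ scalarWeight E :=
  Finset.prod_nonneg fun _ _ => by positivity

theorem scalarWeight_one_pos [∀ p, DecidableEq (σ p)] [∀ p, Nonempty (σ p)] :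
    0 < scalarWeight (1 : ∀ p, Matrix (σ p) (σ p) ℂ) :=
  Finset.prod_pos fun p _ => by simp [normTrace_one]

variable [DecidableEq P] {I : Type} [Fintype I]

/-- The total overlap that the operator `⨂ p, E p` creates between different product vectors of
the family `a`. -/
def overlap (a : I → ∀ p, EuclideanSpace ℂ (σ p)) (E : ∀ p, Matrix (σ p) (σ p) ℂ) : ℝ :=
  ∑ x ∈ (Finset.univ : Finset I).offDiag,
    ‖inner ℂ (productVec (a x.1)) (applyLocal E (productVec (a x.2)))‖

theorem overlap_nonneg (a : I → ∀ p, EuclideanSpace ℂ (σ p))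
    (E : ∀ p, Matrix (σ p) (σ p) ℂ) : 0 ≤ overlap a E :=
  Finset.sum_nonneg fun _ _ => norm_nonneg _

theorem overlap_update_sum_le (a : I → ∀ p, EuclideanSpace ℂ (σ p))
    (E : ∀ p, Matrix (σ p) (σ p) ℂ) (p : P) {α : Type} (s : Finset α)
    (F : α → Matrix (σ p) (σ p) ℂ) :
    overlap a (update E p (∑ o ∈ s, F o)) ≤ ∑ o ∈ s, overlap a (update E p (F o)) := by
  simp only [overlap]
  rw [Finset.sum_comm]
  refine Finset.sum_le_sum fun x _ => ?_
  rw [applyLocal_update_sum, inner_sum]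
  exact norm_sum_le _ _

theorem scalarWeight_update_sum_le (E : ∀ p, Matrix (σ p) (σ p) ℂ) (p : P) {α : Type}
    (s : Finset α) (F : α → Matrix (σ p) (σ p) ℂ) :
    scalarWeight (update E p (∑ o ∈ s, F o)) ≤ ∑ o ∈ s, scalarWeight (update E p (F o)) := by
  have split (G : Matrix (σ p) (σ p) ℂ) : scalarWeight (update E p G)
      = ‖normTrace G‖ / 2 * ∏ q ∈ Finset.univ.erase p, ‖normTrace (E q)‖ / 2 := by
    rw [scalarWeight, ← Finset.mul_prod_erase _ _ (Finset.mem_univ p), update_self]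
    congr 1
    exact Finset.prod_congr rfl fun q hq => by rw [update_of_ne (Finset.ne_of_mem_erase hq)]
  simp only [split, ← Finset.sum_mul, ← Finset.sum_div, map_sum]
  gcongr
  exact norm_sum_le _ _

theorem inner_productVec_applyLocal_update_one [∀ p, DecidableEq (σ p)]
    (φ χ : ∀ p, EuclideanSpace ℂ (σ p)) (p : P) (G : Matrix (σ p) (σ p) ℂ) :
    inner ℂ (productVec φ) (applyLocal (update 1 p G) (productVec χ))
      = inner ℂ (φ p) (toEuclideanLin G (χ p))
        * ∏ q ∈ Finset.univ.erase p, inner ℂ (φ q) (χ q) := by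
  rw [inner_productVec_applyLocal, ← Finset.mul_prod_erase _ _ (Finset.mem_univ p), update_self]
  congr 1
  refine Finset.prod_congr rfl fun q hq => ?_
  simp [update_of_ne (Finset.ne_of_mem_erase hq)]

end ProductOperators

/-- A family of product states is locally stable if it is orthonormal and no party can begin with
a nontrivial measurement that preserves orthogonality: an operator `G` of a single party with
`⟨ψ i, (G ⊗ 1) ψ j⟩ = 0` for all `i ≠ j` is a scalar. The states are given by their local unit
factors `a i p`. -/
structure LocallyStable {P I : Type} [Fintype P] [DecidableEq P] {σ : P → Type}
    [∀ p, Fintype (σ p)] [∀ p, DecidableEq (σ p)] (a : I → ∀ p, EuclideanSpace ℂ (σ p)) :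
    Prop where
  norm_eq_one : ∀ i p, ‖a i p‖ = 1
  orthogonal : Pairwise fun i j => inner ℂ (productVec (a i)) (productVec (a j)) = 0
  eq_smul_one : ∀ (p : P) (G : Matrix (σ p) (σ p) ℂ),
    (Pairwise fun i j =>
      inner ℂ (productVec (a i)) (applyLocal (update 1 p G) (productVec (a j))) = 0) →
    ∃ c : ℂ, G = c • 1

theorem LocallyStable.nonempty_label {P I : Type} [Fintype P] [DecidableEq P] {σ : P → Type}
    [∀ p, Fintype (σ p)] [∀ p, DecidableEq (σ p)] [Nonempty I]
    {a : I → ∀ p, EuclideanSpace ℂ (σ p)} (ha : LocallyStable a) (p : P) : Nonempty (σ p) := by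
  by_contra h
  rw [not_nonempty_iff] at h
  obtain ⟨i⟩ : Nonempty I := inferInstance
  simpa [Subsingleton.elim (a i p) 0] using ha.norm_eq_one i p

/-- A tolerance `ε` for calling the local operators of a locally stable family `a` close to
scalars: overlaps of local factors exceed it, and it makes the stability of `a` quantitative. -/
structure IsTolerance {P I : Type} [Fintype P] [DecidableEq P] [Fintype I] {σ : P → Type}
    [∀ p, Fintype (σ p)] [∀ p, DecidableEq (σ p)] (a : I → ∀ p, EuclideanSpace ℂ (σ p))
    (ε : ℝ) : Prop where
  pos : 0 < ε
  le_one : ε ≤ 1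
  le_half_norm_inner : ∀ i j p, inner ℂ (a i p) (a j p) ≠ 0 → ε ≤ ‖inner ℂ (a i p) (a j p)‖ / 2
  mul_norm_sub_le : ∀ p (G : Matrix (σ p) (σ p) ℂ),
    ε * ‖G - normTrace G • 1‖ ≤ overlap a (update 1 p G)

section LocalStability

variable {P I : Type} [Fintype P] [DecidableEq P] [Fintype I] {σ : P → Type}
  [∀ p, Fintype (σ p)] [∀ p, DecidableEq (σ p)] {a : I → ∀ p, EuclideanSpace ℂ (σ p)}

/-- The matrix elements of an operator of the party `p` between different states. -/
def crossElements (a : I → ∀ p, EuclideanSpace ℂ (σ p)) (p : P) :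
    Matrix (σ p) (σ p) ℂ →ₗ[ℂ] ((Finset.univ : Finset I).offDiag → ℂ) where
  toFun G x := inner ℂ (productVec (a x.1.1)) (applyLocal (update 1 p G) (productVec (a x.1.2)))
  map_add' G H := by
    ext x
    simp [inner_productVec_applyLocal_update_one, add_mul]
  map_smul' c G := by
    ext x
    simp [inner_productVec_applyLocal_update_one, mul_assoc]

theorem norm_crossElements_le_overlap (a : I → ∀ p, EuclideanSpace ℂ (σ p)) (p : P)
    (G : Matrix (σ p) (σ p) ℂ) : ‖crossElements a p G‖ ≤ overlap a (update 1 p G) :=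
  (pi_norm_le_iff_of_nonneg (overlap_nonneg _ _)).2 fun x =>
    Finset.single_le_sum (f := fun x : I × I =>
      ‖inner ℂ (productVec (a x.1)) (applyLocal (update 1 p G) (productVec (a x.2)))‖)
      (fun _ _ => norm_nonneg _) x.2

theorem LocallyStable.exists_antilipschitz (ha : LocallyStable a) (p : P) [Nonempty (σ p)] :
    ∃ K > 0, ∀ G : Matrix (σ p) (σ p) ℂ,
      ‖G - normTrace G • 1‖ ≤ K * overlap a (update 1 p G) := by
  set L := (crossElements a p).prod normTrace
  have injective : LinearMap.ker L = ⊥ := by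
    refine LinearMap.ker_eq_bot'.2 fun G hG => ?_
    obtain ⟨hG, h_trace⟩ := Prod.mk_eq_zero.1 hG
    obtain ⟨c, rfl⟩ := ha.eq_smul_one p G fun i j hij =>
      congrFun hG ⟨(i, j), by simpa using hij⟩
    rw [map_smul, normTrace_one, smul_eq_mul, mul_one] at h_trace
    rw [h_trace, zero_smul]
  have cross_one : crossElements a p 1 = 0 := by
    ext x
    simpa [crossElements, applyLocal_one] using
      ha.orthogonal (Finset.mem_offDiag.1 x.2).2.2
  obtain ⟨K, K_pos, hK⟩ := L.exists_antilipschitzWith injective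
  refine ⟨K, K_pos, fun G => ?_⟩
  calc ‖G - normTrace G • 1‖ ≤ K * ‖L (G - normTrace G • 1)‖ := by
        simpa using hK.le_mul_dist (G - normTrace G • 1) 0
    _ = K * ‖crossElements a p G‖ := by simp [L, cross_one, normTrace_one, Prod.norm_def]
    _ ≤ K * overlap a (update 1 p G) := by gcongr; exact norm_crossElements_le_overlap a p G

theorem LocallyStable.exists_isTolerance (ha : LocallyStable a) [∀ p, Nonempty (σ p)] :
    ∃ ε, IsTolerance a ε := by
  have small {x : ℝ} (hx : 0 < x) : ∀ᶠ ε in 𝓝[>] 0, ε ≤ x :=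
    nhdsWithin_le_nhds (Iic_mem_nhds hx)
  have le_half_norm_inner : ∀ᶠ ε in 𝓝[>] (0 : ℝ), ∀ i j p,
      inner ℂ (a i p) (a j p) ≠ 0 → ε ≤ ‖inner ℂ (a i p) (a j p)‖ / 2 := by
    simp only [eventually_all]
    exact fun i j p h => small (by positivity)
  have mul_norm_sub_le : ∀ᶠ ε in 𝓝[>] (0 : ℝ), ∀ p (G : Matrix (σ p) (σ p) ℂ),
      ε * ‖G - normTrace G • 1‖ ≤ overlap a (update 1 p G) := by
    refine eventually_all.2 fun p => ?_
    obtain ⟨K, K_pos, hK⟩ := ha.exists_antilipschitz p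
    filter_upwards [small (inv_pos.2 K_pos)] with ε hε G
    calc ε * ‖G - normTrace G • 1‖ ≤ K⁻¹ * (K * overlap a (update 1 p G)) := by
          gcongr
          exact hK G
      _ = overlap a (update 1 p G) := inv_mul_cancel_left₀ K_pos.ne' _
  obtain ⟨ε, ⟨pos, le_one⟩, h_inner, h_sub⟩ := ((eventually_mem_nhdsWithin.and
    (small one_pos)).and (le_half_norm_inner.and mul_norm_sub_le)).exists
  exact ⟨ε, pos, le_one, h_inner, h_sub⟩

namespace IsTolerance

variable {ε : ℝ} {E : ∀ p, Matrix (σ p) (σ p) ℂ}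

theorem scalarWeight_le_norm_inner (hε : IsTolerance a ε) (ha : LocallyStable a)
    (hE : ∀ p, NearScalar ε (E p)) (i : I) :
    scalarWeight E ≤ ‖inner ℂ (productVec (a i)) (applyLocal E (productVec (a i)))‖ := by
  rw [inner_productVec_applyLocal, norm_prod]
  refine Finset.prod_le_prod (fun p _ => by positivity) fun p _ => ?_
  simpa [ha.norm_eq_one] using (hE p).half_mul_norm_inner_le (ha.norm_eq_one i p)
    (ha.norm_eq_one i p) (hε.le_half_norm_inner i i p)

theorem prod_erase_mul_norm_inner_le (hε : IsTolerance a ε) (ha : LocallyStable a) {p : P}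
    (hE : ∀ q ≠ p, NearScalar ε (E q)) (i j : I) :
    (∏ q ∈ Finset.univ.erase p, ‖normTrace (E q)‖ / 2)
        * ‖inner ℂ (productVec (a i)) (applyLocal (update 1 p (E p)) (productVec (a j)))‖
      ≤ ‖inner ℂ (productVec (a i)) (applyLocal E (productVec (a j)))‖ := by
  rw [inner_productVec_applyLocal_update_one, inner_productVec_applyLocal,
    ← Finset.mul_prod_erase _ _ (Finset.mem_univ p), norm_mul, norm_mul, norm_prod, norm_prod,
    mul_left_comm, ← Finset.prod_mul_distrib]
  gcongr with q hq
  exact (hE q (Finset.ne_of_mem_erase hq)).half_mul_norm_inner_le (ha.norm_eq_one i q)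
    (ha.norm_eq_one j q) (hε.le_half_norm_inner i j q)

/-- A product operator that is about to leave the scalars, its factor at `p` being the first to do
so, creates a proportional overlap. -/
theorem mul_scalarWeight_le_overlap (hε : IsTolerance a ε) (ha : LocallyStable a) {p : P}
    (hE : ∀ q ≠ p, NearScalar ε (E q)) (hp : ¬NearScalar ε (E p)) :
    ε ^ 2 * scalarWeight E ≤ overlap a E := by
  set w := ∏ q ∈ Finset.univ.erase p, ‖normTrace (E q)‖ / 2
  have : 0 ≤ w := Finset.prod_nonneg fun _ _ => by positivity
  have far : ε * ‖normTrace (E p)‖ ≤ ‖E p - normTrace (E p) • 1‖ := (not_le.1 hp).le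
  have ε_pos := hε.pos
  calc ε ^ 2 * scalarWeight E = w * (ε * (ε * (‖normTrace (E p)‖ / 2))) := by
        rw [scalarWeight, ← Finset.mul_prod_erase _ _ (Finset.mem_univ p)]
        ring
    _ ≤ w * (ε * (ε * ‖normTrace (E p)‖)) := by gcongr; exact half_le_self (norm_nonneg _)
    _ ≤ w * overlap a (update 1 p (E p)) := by
        gcongr
        exact (mul_le_mul_of_nonneg_left far ε_pos.le).trans (hε.mul_norm_sub_le p (E p))
    _ ≤ overlap a E := by
        rw [overlap, Finset.mul_sum]
        exact Finset.sum_le_sum fun x _ => hε.prod_erase_mul_norm_inner_le ha hE x.1 x.2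

end IsTolerance

open Classical in
/-- A subadditive measure of how far the states of the family `a` are from being distinguished by
an outcome with effect `⨂ p, E p`. -/
def potential (a : I → ∀ p, EuclideanSpace ℂ (σ p)) (ε : ℝ) (E : ∀ p, Matrix (σ p) (σ p) ℂ) :
    ℝ :=
  max (overlap a E) (if ∀ p, NearScalar ε (E p) then ε ^ 2 * scalarWeight E else 0)

theorem potential_nonneg (ε : ℝ) (E : ∀ p, Matrix (σ p) (σ p) ℂ) : 0 ≤ potential a ε E :=
  (overlap_nonneg a E).trans (le_max_left _ _)

theorem IsTolerance.mul_scalarWeight_le_potential {ε : ℝ} (hε : IsTolerance a ε)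
    (ha : LocallyStable a) {E : ∀ p, Matrix (σ p) (σ p) ℂ} {p : P}
    (hE : ∀ q ≠ p, NearScalar ε (E q)) : ε ^ 2 * scalarWeight E ≤ potential a ε E := by
  by_cases hp : NearScalar ε (E p)
  · have all : ∀ q, NearScalar ε (E q) := fun q =>
      (eq_or_ne q p).elim (fun h => h ▸ hp) (hE q)
    rw [potential, if_pos all]
    exact le_max_right _ _
  · exact (hε.mul_scalarWeight_le_overlap ha hE hp).trans (le_max_left _ _)

theorem IsTolerance.potential_update_sum_le {ε : ℝ} (hε : IsTolerance a ε)
    (ha : LocallyStable a) (E : ∀ p, Matrix (σ p) (σ p) ℂ) (p : P) {α : Type} (s : Finset α)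
    (F : α → Matrix (σ p) (σ p) ℂ) :
    potential a ε (update E p (∑ o ∈ s, F o)) ≤ ∑ o ∈ s, potential a ε (update E p (F o)) := by
  conv_lhs => rw [potential]
  refine max_le ((overlap_update_sum_le a E p s F).trans
    (Finset.sum_le_sum fun o _ => le_max_left _ _)) ?_
  split_ifs with near
  · have near_of_ne (o : α) (q : P) (hq : q ≠ p) : NearScalar ε (update E p (F o) q) := by
      simpa only [update_of_ne hq] using near q
    calc ε ^ 2 * scalarWeight (update E p (∑ o ∈ s, F o))
        ≤ ε ^ 2 * ∑ o ∈ s, scalarWeight (update E p (F o)) := by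
          gcongr
          exact scalarWeight_update_sum_le E p s F
      _ ≤ ∑ o ∈ s, potential a ε (update E p (F o)) := by
          rw [Finset.mul_sum]
          exact Finset.sum_le_sum fun o _ => hε.mul_scalarWeight_le_potential ha (near_of_ne o)
  · exact Finset.sum_nonneg fun o _ => potential_nonneg ε _

theorem IsTolerance.potential_effect_le [Nontrivial I] {ε : ℝ} (hε : IsTolerance a ε)
    (ha : LocallyStable a) (π : LOCCProtocol P σ) (h : List ℕ) :
    potential a ε (π.effect h) ≤ ∑ x ∈ (Finset.univ : Finset I).offDiag,
      √(π.recordProb (productVec (a x.1)) h) * √(π.recordProb (productVec (a x.2)) h) := by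
  set r := fun i => √(π.recordProb (productVec (a i)) h)
  refine max_le (Finset.sum_le_sum fun x _ => π.norm_inner_applyLocal_effect_le _ _ h) ?_
  split_ifs with near
  · obtain ⟨i, j, hij⟩ := exists_pair_ne I
    have weight_le (k : I) : scalarWeight (π.effect h) ≤ r k * r k :=
      (hε.scalarWeight_le_norm_inner ha near k).trans (π.norm_inner_applyLocal_effect_le _ _ h)
    calc ε ^ 2 * scalarWeight (π.effect h) ≤ scalarWeight (π.effect h) :=
          mul_le_of_le_one_left (scalarWeight_nonneg _) (pow_le_one₀ hε.pos.le hε.le_one)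
      _ ≤ r i * r j := by
          obtain hle | hle := le_total (r i) (r j)
          · exact (weight_le i).trans (by gcongr)
          · exact (weight_le j).trans (by gcongr)
      _ ≤ ∑ x ∈ (Finset.univ : Finset I).offDiag, r x.1 * r x.2 :=
          Finset.single_le_sum (f := fun x : I × I => r x.1 * r x.2)
            (fun _ _ => by positivity) (a := (i, j)) (by simpa using hij)
  · positivity

theorem LocallyStable.tendsto_sum_affinity (ha : LocallyStable a) {π : LOCCProtocol P σ}
    {guess : List ℕ → StateVec σ}
    (success : ∀ i, Tendsto (fun n => π.successProb guess n (productVec (a i))) atTop (𝓝 1)) :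
    Tendsto (fun n => ∑ x ∈ (Finset.univ : Finset I).offDiag,
      π.affinity (productVec (a x.1)) (productVec (a x.2)) n) atTop (𝓝 0) := by
  have norm_one (i : I) : ‖productVec (a i)‖ = 1 := norm_productVec_eq_one (ha.norm_eq_one i)
  have ne {i j : I} (hij : i ≠ j) : productVec (a i) ≠ productVec (a j) := by
    intro h_eq
    have h_self : inner ℂ (productVec (a i)) (productVec (a j)) = 0 := ha.orthogonal hij
    rw [h_eq, inner_self_eq_one_of_norm_eq_one (norm_one j)] at h_self
    exact one_ne_zero h_self
  rw [← Finset.sum_const_zero (s := (Finset.univ : Finset I).offDiag)]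
  exact tendsto_finsetSum _ fun x hx => LOCCProtocol.tendsto_affinity (norm_one _) (norm_one _)
    (ne (Finset.mem_offDiag.1 hx).2.2) (success _) (success _)

end LocalStability

theorem LocallyStable.not_loccDistinguishable {P I : Type} [Fintype P] [DecidableEq P] [Finite I]
    [Nontrivial I] {σ : P → Type} [∀ p, Fintype (σ p)] [∀ p, DecidableEq (σ p)]
    {a : I → ∀ p, EuclideanSpace ℂ (σ p)} (ha : LocallyStable a)
    {S : Set (StateVec σ)} (hS : ∀ i, productVec (a i) ∈ S) : ¬LOCCDistinguishable S := by
  rintro ⟨π, guess, success⟩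
  have := ha.nonempty_label
  have := Fintype.ofFinite I
  obtain ⟨ε, hε⟩ := ha.exists_isTolerance
  have lower (n : ℕ) : ε ^ 2 * scalarWeight (1 : ∀ p, Matrix (σ p) (σ p) ℂ)
      ≤ ∑ x ∈ (Finset.univ : Finset I).offDiag,
        π.affinity (productVec (a x.1)) (productVec (a x.2)) n :=
    calc ε ^ 2 * scalarWeight (1 : ∀ p, Matrix (σ p) (σ p) ℂ) ≤ potential a ε 1 := by
          have near_one (p : P) : NearScalar ε ((1 : ∀ p, Matrix (σ p) (σ p) ℂ) p) :=
            nearScalar_one hε.pos.le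
          rw [potential, if_pos near_one]
          exact le_max_right _ _
      _ ≤ ∑ h ∈ π.records n, potential a ε (π.effect h) :=
          π.le_sum_records_of_subadditive (hε.potential_update_sum_le ha · · · ·) n
      _ ≤ _ := by
          simp only [LOCCProtocol.affinity]
          rw [Finset.sum_comm]
          exact Finset.sum_le_sum fun h _ => hε.potential_effect_le ha π h
  have weight_pos : 0 < ε ^ 2 * scalarWeight (1 : ∀ p, Matrix (σ p) (σ p) ℂ) :=
    mul_pos (pow_pos hε.pos 2) scalarWeight_one_pos
  exact (ge_of_tendsto' (ha.tendsto_sum_affinity fun i => success _ (hS i)) lower).not_gt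
    weight_pos

section LocalIsometries

variable {P : Type} {σ τ : P → Type} [∀ p, Fintype (σ p)] [∀ p, Fintype (τ p)]
  [∀ p, DecidableEq (σ p)] [∀ p, DecidableEq (τ p)]

/-- The protocol that first embeds the systems of the parties by the local isometries `V` and then
follows `π`. -/
def LOCCProtocol.precomp (π : LOCCProtocol P τ) (V : ∀ p, Matrix (τ p) (σ p) ℂ)
    (hV : ∀ p, (V p)ᴴ * V p = 1) : LOCCProtocol P σ where
  dim := π.dim
  prep p := π.prep p * V p
  prep_isometry p := by
    rw [conjTranspose_mul, Matrix.mul_assoc, ← Matrix.mul_assoc _ (π.prep p), π.prep_isometry,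
      Matrix.one_mul, hV]
  actor := π.actor
  outcomes := π.outcomes
  kraus := π.kraus
  kraus_complete := π.kraus_complete
  kraus_isometry := π.kraus_isometry

theorem LOCCProtocol.accumulated_precomp (π : LOCCProtocol P τ) (V : ∀ p, Matrix (τ p) (σ p) ℂ)
    (hV : ∀ p, (V p)ᴴ * V p = 1) (p : P) (h : List ℕ) :
    (π.precomp V hV).accumulated p h = π.accumulated p h * V p := by
  induction h with
  | nil => rfl
  | cons o h ih =>
    exact (congrArg (fun A : Matrix (Fin (π.dim p h)) (σ p) ℂ => π.kraus p h o * A) ih).trans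
      (Matrix.mul_assoc _ _ _).symm

theorem LOCCProtocol.records_precomp (π : LOCCProtocol P τ) (V : ∀ p, Matrix (τ p) (σ p) ℂ)
    (hV : ∀ p, (V p)ᴴ * V p = 1) (n : ℕ) : (π.precomp V hV).records n = π.records n := by
  induction n with
  | zero => rfl
  | succ n ih => simp only [records, ih]; rfl

variable [Fintype P] [DecidableEq P]

theorem LOCCProtocol.recordProb_precomp (π : LOCCProtocol P τ) (V : ∀ p, Matrix (τ p) (σ p) ℂ)
    (hV : ∀ p, (V p)ᴴ * V p = 1) (ψ : StateVec σ) (h : List ℕ) :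
    (π.precomp V hV).recordProb ψ h = π.recordProb (applyLocal V ψ) h := by
  simp only [recordProb, accumulated_precomp, applyLocal_applyLocal]
  rfl

theorem LOCCProtocol.successProb_le_successProb_precomp (π : LOCCProtocol P τ)
    {V : ∀ p, Matrix (τ p) (σ p) ℂ} (hV : ∀ p, (V p)ᴴ * V p = 1)
    (guess : List ℕ → StateVec τ) (n : ℕ) (ψ : StateVec σ) :
    π.successProb guess n (applyLocal V ψ)
      ≤ (π.precomp V hV).successProb (fun h => applyLocal (fun p => (V p)ᴴ) (guess h)) n ψ := by
  classical
  simp only [successProb, records_precomp, recordProb_precomp]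
  refine Finset.sum_le_sum_of_subset_of_nonneg (Finset.monotone_filter_right _ fun h _ h_eq => ?_)
    fun h _ _ => π.recordProb_nonneg _ h
  rw [h_eq, applyLocal_conjTranspose_applyLocal hV]

theorem LOCCDistinguishable.of_image_applyLocal {V : ∀ p, Matrix (τ p) (σ p) ℂ}
    (hV : ∀ p, (V p)ᴴ * V p = 1) {S : Set (StateVec σ)} (hS : ∀ ψ ∈ S, ‖ψ‖ = 1)
    (h : LOCCDistinguishable (applyLocal V '' S)) : LOCCDistinguishable S := by
  obtain ⟨π, guess, success⟩ := h
  exact ⟨π.precomp V hV, _, fun ψ hψ => tendsto_of_tendsto_of_tendsto_of_le_of_le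
    (success _ ⟨ψ, hψ, rfl⟩) tendsto_const_nhds
    (fun n => π.successProb_le_successProb_precomp hV guess n ψ)
    fun n => (π.precomp V hV).successProb_le_one _ n (hS ψ hψ)⟩

theorem LOCCDistinguishable.mono {S T : Set (StateVec σ)} (hST : S ⊆ T)
    (h : LOCCDistinguishable T) : LOCCDistinguishable S :=
  let ⟨π, guess, success⟩ := h
  ⟨π, guess, fun ψ hψ => success ψ (hST hψ)⟩

end LocalIsometries

section Grouping

theorem orthonormal_productVec_update {P κ : Type} [Fintype P] [DecidableEq P] {σ : P → Type}
    [∀ p, Fintype (σ p)] {φ : ∀ p, EuclideanSpace ℂ (σ p)} (hφ : ∀ p, ‖φ p‖ = 1) (p : P)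
    {v : κ → EuclideanSpace ℂ (σ p)} (hv : Orthonormal ℂ v) :
    Orthonormal ℂ fun k => productVec (update φ p (v k)) := by
  classical
  refine orthonormal_iff_ite.2 fun k l => ?_
  rw [inner_productVec, ← Finset.mul_prod_erase _ _ (Finset.mem_univ p), update_self, update_self,
    orthonormal_iff_ite.1 hv k l, Finset.prod_eq_one, mul_one]
  intro q hq
  rw [update_of_ne (Finset.ne_of_mem_erase hq), update_of_ne (Finset.ne_of_mem_erase hq)]
  exact inner_self_eq_one_of_norm_eq_one (hφ q)

theorem LocallyStable.not_loccDistinguishable_of_orthonormal {P I : Type} [Fintype P]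
    [DecidableEq P] [Finite I] [Nontrivial I] {κ τ : P → Type} [∀ p, Fintype (κ p)]
    [∀ p, DecidableEq (κ p)] [∀ p, Fintype (τ p)] [∀ p, DecidableEq (τ p)]
    {a : I → ∀ p, EuclideanSpace ℂ (κ p)} (ha : LocallyStable a)
    {v : ∀ p, κ p → EuclideanSpace ℂ (τ p)} (hv : ∀ p, Orthonormal ℂ (v p))
    {S : Set (StateVec τ)} (hS : ∀ i, productVec (fun p => ∑ k, a i p k • v p k) ∈ S) :
    ¬LOCCDistinguishable S := by
  set V : ∀ p, Matrix (τ p) (κ p) ℂ := fun p => of fun x k => v p k x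
  have isometry (p : P) : (V p)ᴴ * V p = 1 := by
    ext k l
    rw [one_apply, ← orthonormal_iff_ite.1 (hv p) k l, PiLp.inner_apply]
    simp only [V, mul_apply, conjTranspose_apply, of_apply, RCLike.inner_apply, mul_comm,
      RCLike.star_def]
  have embed (i : I) :
      applyLocal V (productVec (a i)) = productVec fun p => ∑ k, a i p k • v p k := by
    rw [applyLocal_productVec]
    congr 1
    ext p x
    simp [V, mulVec, dotProduct, mul_comm]
  intro hS'
  refine ha.not_loccDistinguishable (S := Set.range fun i => productVec (a i)) Set.mem_range_self
    (LOCCDistinguishable.of_image_applyLocal isometry ?_ (hS'.mono ?_))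
  · rintro _ ⟨i, rfl⟩
    exact norm_productVec_eq_one (ha.norm_eq_one i)
  · rintro _ ⟨_, ⟨i, rfl⟩, rfl⟩
    exact (embed i).symm ▸ hS i

variable {P Q : Type} [Fintype P] [DecidableEq P] [Fintype Q] [DecidableEq Q] {σ : P → Type}
  [∀ p, Fintype (σ p)]

theorem groupParties_productVec (f : P → Q) (φ : ∀ p, EuclideanSpace ℂ (σ p)) :
    groupParties f (productVec φ)
      = productVec fun q => productVec fun i : {i : P // f i = q} => φ i := by
  ext x
  simp only [groupParties, productVec]
  rw [← Fintype.prod_fiberwise f]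
  refine Finset.prod_congr rfl fun q _ => Finset.prod_congr rfl fun i _ => ?_
  obtain ⟨i, rfl⟩ := i
  rfl

variable {κ : Type} [Fintype κ]

/-- The local vectors when, in each group `q` of the parties, the representative `g q` holds the
vector with coordinates `c q` in the family `w (g q)`, while every other party `p` is a spectator
and holds the fixed vector `χ p`. -/
def withSpectators (f : P → Q) (g : Q → P) (w : ∀ p, κ → EuclideanSpace ℂ (σ p))
    (χ : ∀ p, EuclideanSpace ℂ (σ p)) (c : Q → EuclideanSpace ℂ κ) (p : P) :
    EuclideanSpace ℂ (σ p) :=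
  if p = g (f p) then ∑ k, c (f p) k • w p k else χ p

theorem groupParties_productVec_withSpectators {f : P → Q} {g : Q → P} (hg : ∀ q, f (g q) = q)
    (w : ∀ p, κ → EuclideanSpace ℂ (σ p)) (χ : ∀ p, EuclideanSpace ℂ (σ p))
    (c : Q → EuclideanSpace ℂ κ) :
    groupParties f (productVec (withSpectators f g w χ c))
      = productVec fun q => ∑ k, c q k •
          productVec (update (fun i : {i : P // f i = q} => χ i) ⟨g q, hg q⟩ (w (g q) k)) := by
  rw [groupParties_productVec]
  congr 1
  funext q
  rw [← productVec_update_sum_smul]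
  congr 1
  refine eq_update_iff.2 ⟨by simp [withSpectators, hg], ?_⟩
  rintro ⟨p, rfl⟩ hp
  exact if_neg fun h => hp (Subtype.ext h)

theorem LocallyStable.not_loccDistinguishable_groupParties {I : Type} [Finite I] [Nontrivial I]
    [DecidableEq κ] [∀ p, DecidableEq (σ p)] {a : I → Q → EuclideanSpace ℂ κ}
    (ha : LocallyStable a) {f : P → Q} {g : Q → P} (hg : ∀ q, f (g q) = q)
    {w : ∀ p, κ → EuclideanSpace ℂ (σ p)} (hw : ∀ p, Orthonormal ℂ (w p))
    {χ : ∀ p, EuclideanSpace ℂ (σ p)} (hχ : ∀ p, ‖χ p‖ = 1) {S : Set (StateVec σ)}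
    (hS : ∀ i, productVec (withSpectators f g w χ (a i)) ∈ S) :
    ¬LOCCDistinguishable (groupParties f '' S) :=
  ha.not_loccDistinguishable_of_orthonormal
    (fun q => orthonormal_productVec_update (P := {p : P // f p = q}) (fun p => hχ p) ⟨g q, hg q⟩
      (hw (g q)))
    fun i => ⟨_, hS i, groupParties_productVec_withSpectators hg w χ (a i)⟩

end Grouping

section IntegerVectors

variable {ι : Type} [Fintype ι]

/-- A vector with integer coordinates. Orthogonality of such vectors is decidable. -/
def intVec (c : ι → ℤ) : EuclideanSpace ℂ ι :=
  WithLp.toLp 2 fun i => (c i : ℂ)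

theorem inner_intVec (c d : ι → ℤ) : inner ℂ (intVec c) (intVec d) = ((c ⬝ᵥ d : ℤ) : ℂ) := by
  simp [intVec, PiLp.inner_apply, dotProduct, mul_comm]

theorem inner_intVec_toEuclideanLin [DecidableEq ι] (G : Matrix ι ι ℂ) (c d : ι → ℤ) :
    inner ℂ (intVec c) (toEuclideanLin G (intVec d)) = ∑ k, ∑ l, (c k : ℂ) * G k l * d l := by
  simp only [intVec, PiLp.inner_apply, RCLike.inner_apply, toLpLin_toLp, mulVec, dotProduct,
    toLin'_apply, Finset.sum_mul, map_intCast]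
  exact Finset.sum_congr rfl fun k _ => Finset.sum_congr rfl fun l _ => by ring

/-- The unit vector on the ray of `intVec c`, with the junk value `0` for `c = 0`. -/
def unitIntVec (c : ι → ℤ) : EuclideanSpace ℂ ι :=
  (((√(c ⬝ᵥ c : ℤ))⁻¹ : ℝ) : ℂ) • intVec c

theorem norm_intVec (c : ι → ℤ) : ‖intVec c‖ = √(c ⬝ᵥ c : ℤ) := by
  rw [norm_eq_sqrt_re_inner (𝕜 := ℂ), inner_intVec]
  simp

theorem norm_intVec_ne_zero {c : ι → ℤ} (hc : c ≠ 0) : ‖intVec c‖ ≠ 0 := by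
  rw [norm_ne_zero_iff]
  contrapose! hc
  ext i
  simpa [intVec] using congr($hc i)

theorem norm_unitIntVec {c : ι → ℤ} (hc : c ≠ 0) : ‖unitIntVec c‖ = 1 := by
  rw [unitIntVec, ← norm_intVec, norm_smul, Complex.norm_real, norm_inv, norm_norm,
    inv_mul_cancel₀ (norm_intVec_ne_zero hc)]

theorem inner_unitIntVec_eq_zero_iff {c d : ι → ℤ} (hc : c ≠ 0) (hd : d ≠ 0) :
    inner ℂ (unitIntVec c) (unitIntVec d) = 0 ↔ c ⬝ᵥ d = 0 := by
  rw [unitIntVec, unitIntVec, ← norm_intVec, ← norm_intVec, inner_smul_left, inner_smul_right,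
    inner_intVec]
  simp [norm_intVec_ne_zero hc, norm_intVec_ne_zero hd, -norm_eq_zero]

theorem inner_unitIntVec_toEuclideanLin_eq_zero_iff [DecidableEq ι] (G : Matrix ι ι ℂ)
    {c d : ι → ℤ} (hc : c ≠ 0) (hd : d ≠ 0) :
    inner ℂ (unitIntVec c) (toEuclideanLin G (unitIntVec d)) = 0
      ↔ ∑ k, ∑ l, (c k : ℂ) * G k l * d l = 0 := by
  rw [unitIntVec, unitIntVec, ← norm_intVec, ← norm_intVec, map_smul, inner_smul_left,
    inner_smul_right, inner_intVec_toEuclideanLin]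
  simp [norm_intVec_ne_zero hc, norm_intVec_ne_zero hd, -norm_eq_zero]

end IntegerVectors

section Domino

/-- The integer coordinates of the local vectors `|0⟩`, `|0⟩ ± |1⟩`, `|2⟩`, `|1⟩ ± |2⟩`, in cyclic
order. -/
def tileInt (t : Fin 4) (s : Fin 2) : Fin 3 → ℤ :=
  ![![1, 0, 0], ![1, (-1) ^ (s : ℕ), 0], ![0, 0, 1], ![0, 1, (-1) ^ (s : ℕ)]] t

/-- The local unit vectors from which the domino states are made. -/
def tile (t : Fin 4) (s : Fin 2) : EuclideanSpace ℂ (Fin 3) :=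
  unitIntVec (tileInt t s)

/-- The local factors of the eight domino states `tile t s ⊗ tile (t + 1) s` of two qutrits,
where the first factor belongs to the party `first`. This is the domino basis of Bennett et al.
without the state `|1⟩|1⟩`. -/
def domino (first : Bool) (i : Fin 4 × Fin 2) (q : Bool) : EuclideanSpace ℂ (Fin 3) :=
  if q = first then tile i.1 i.2 else tile (i.1 + 1) i.2

theorem tileInt_ne_zero (t : Fin 4) (s : Fin 2) : tileInt t s ≠ 0 := by
  decide +revert

theorem inner_tile_eq_zero_iff (t t' : Fin 4) (s s' : Fin 2) :
    inner ℂ (tile t s) (tile t' s') = 0 ↔ tileInt t s ⬝ᵥ tileInt t' s' = 0 :=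
  inner_unitIntVec_eq_zero_iff (tileInt_ne_zero t s) (tileInt_ne_zero t' s')

theorem inner_tile_toEuclideanLin_eq_zero_iff (G : Matrix (Fin 3) (Fin 3) ℂ) (t t' : Fin 4)
    (s s' : Fin 2) : inner ℂ (tile t s) (toEuclideanLin G (tile t' s')) = 0
      ↔ ∑ k, ∑ l, (tileInt t s k : ℂ) * G k l * tileInt t' s' l = 0 :=
  inner_unitIntVec_toEuclideanLin_eq_zero_iff G (tileInt_ne_zero t s) (tileInt_ne_zero t' s')

theorem sum_tile_smul {E : Type} [AddCommGroup E] [Module ℂ E] (v : Fin 3 → E) (t : Fin 4)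
    (s : Fin 2) : ∑ k, tile t s k • v k
      = ![v 0, ((1 / √2 : ℝ) : ℂ) • (v 0 + (-1 : ℂ) ^ (s : ℕ) • v 1),
          v 2, ((1 / √2 : ℝ) : ℂ) • (v 1 + (-1 : ℂ) ^ (s : ℕ) • v 2)] t := by
  have coordinate (k : Fin 3) :
      tile t s k = ((1 / √(![1, 2, 1, 2] t : ℤ) : ℝ) : ℂ) * tileInt t s k := by
    have : tileInt t s ⬝ᵥ tileInt t s = ![1, 2, 1, 2] t := by decide +revert
    rw [tile, unitIntVec, this, one_div]
    rfl
  simp only [coordinate, mul_smul, ← Finset.smul_sum, Fin.sum_univ_three]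
  fin_cases t <;> simp [tileInt]

/-- Orthogonality across different tiles kills the off-diagonal entries of `G`; orthogonality
along the two long tiles then equates the diagonal entries. -/
theorem exists_eq_smul_one_of_inner_tile {G : Matrix (Fin 3) (Fin 3) ℂ}
    (across : ∀ t s s', inner ℂ (tile t s) (toEuclideanLin G (tile (3 - t) s')) = 0)
    (along : ∀ t, inner ℂ (tile (2 * t + 1) 0) (toEuclideanLin G (tile (2 * t + 1) 1)) = 0) :
    ∃ c : ℂ, G = c • 1 := by
  simp only [inner_tile_toEuclideanLin_eq_zero_iff] at across along
  have tile₀₃ : G 0 1 + G 0 2 = 0 ∧ G 0 1 - G 0 2 = 0 := by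
    simpa [Fin.forall_fin_two, Fin.sum_univ_three, tileInt, ← sub_eq_add_neg] using across 0 0
  have tile₁₂ : G 0 2 + G 1 2 = 0 ∧ G 0 2 - G 1 2 = 0 := by
    simpa [Fin.forall_fin_two, Fin.sum_univ_three, tileInt, ← sub_eq_add_neg] using
      fun s => across 1 s 0
  have tile₂₁ : G 2 0 + G 2 1 = 0 ∧ G 2 0 - G 2 1 = 0 := by
    simpa [Fin.forall_fin_two, Fin.sum_univ_three, tileInt, ← sub_eq_add_neg] using across 2 0
  have tile₃₀ : G 1 0 + G 2 0 = 0 ∧ G 1 0 - G 2 0 = 0 := by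
    simpa [Fin.forall_fin_two, Fin.sum_univ_three, tileInt, ← sub_eq_add_neg] using
      fun s => across 3 s 0
  have tile₁₁ : G 0 0 + G 1 0 - (G 0 1 + G 1 1) = 0 := by
    simpa [Fin.sum_univ_three, tileInt, ← sub_eq_add_neg] using along 0
  have tile₃₃ : G 1 1 + G 2 1 - (G 1 2 + G 2 2) = 0 := by
    simpa [Fin.sum_univ_three, tileInt, ← sub_eq_add_neg] using along 1
  refine ⟨G 0 0, ?_⟩
  ext i j
  fin_cases i <;> fin_cases j <;> simp <;> grind

theorem inner_productVec_domino (first : Bool) (i j : Fin 4 × Fin 2) :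
    inner ℂ (productVec (domino first i)) (productVec (domino first j))
      = inner ℂ (tile i.1 i.2) (tile j.1 j.2)
        * inner ℂ (tile (i.1 + 1) i.2) (tile (j.1 + 1) j.2) := by
  rw [inner_productVec, Fintype.prod_bool]
  cases first <;> simp [domino, mul_comm]

theorem locallyStable_domino (first : Bool) : LocallyStable (domino first) := by
  refine ⟨fun i q => ?_, fun i j hij => ?_, fun q G hG => ?_⟩
  · rw [domino]
    split_ifs <;> exact norm_unitIntVec (tileInt_ne_zero _ _)
  · have some_factor_eq_zero : ∀ i j : Fin 4 × Fin 2, i ≠ j →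
        tileInt i.1 i.2 ⬝ᵥ tileInt j.1 j.2 = 0
          ∨ tileInt (i.1 + 1) i.2 ⬝ᵥ tileInt (j.1 + 1) j.2 = 0 := by decide +kernel
    change inner ℂ (productVec (domino first i)) (productVec (domino first j)) = 0
    rw [inner_productVec_domino, mul_eq_zero, inner_tile_eq_zero_iff, inner_tile_eq_zero_iff]
    exact some_factor_eq_zero i j hij
  have form_eq_zero {i j : Fin 4 × Fin 2} (hij : i ≠ j)
      (h : inner ℂ (domino first i !q) (domino first j !q) ≠ 0) :
      inner ℂ (domino first i q) (toEuclideanLin G (domino first j q)) = 0 := by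
    have others : Finset.univ.erase q = {!q} := by cases q <;> rfl
    have product_eq_zero : inner ℂ (productVec (domino first i))
        (applyLocal (update 1 q G) (productVec (domino first j))) = 0 := hG hij
    rw [inner_productVec_applyLocal_update_one, others, Finset.prod_singleton] at product_eq_zero
    exact (mul_eq_zero.1 product_eq_zero).resolve_right h
  obtain rfl | rfl : q = first ∨ q = !first := by cases q <;> cases first <;> simp
  · simp only [domino, Bool.not_eq_self, if_true, if_false, ne_eq, inner_tile_eq_zero_iff]
      at form_eq_zero
    refine exists_eq_smul_one_of_inner_tile
      (fun t s s' => form_eq_zero (i := (t, s)) (j := (3 - t, s')) ?_ ?_)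
      (fun t => form_eq_zero (i := (2 * t + 1, 0)) (j := (2 * t + 1, 1)) ?_ ?_)
    all_goals decide +kernel +revert
  · simp only [domino, Bool.not_eq_self, Bool.not_not, if_true, if_false, ne_eq,
      inner_tile_eq_zero_iff] at form_eq_zero
    refine exists_eq_smul_one_of_inner_tile (fun t s s' => ?_)
      (fun t => form_eq_zero (i := (2 * t, 0)) (j := (2 * t, 1)) ?_ ?_)
    · have before : t - 1 + 1 = t ∧ 2 - t + 1 = 3 - t := by decide +revert
      simpa only [before] using form_eq_zero (i := (t - 1, s)) (j := (2 - t, s'))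
        (by decide +kernel +revert) (by decide +kernel +revert)
    all_goals decide +kernel +revert

end Domino

namespace SigmaStates

/-- Labels of the states of `Σ`: seven families of two and seven families of four states. -/
abbrev Index : Type := (Fin 7 × Fin 2) ⊕ (Fin 7 × Fin 2 × Fin 2)

/-- The three kinds of local vectors that occur in the states of `Σ`. -/
inductive Factor
  | ket (l : ℕ)
  | pair (a b : ℕ) (s : Fin 2)
  | quad (a b c d : ℕ) (i j : Fin 2)

namespace Factor

/-- The local vector. In `quad` the third sign is determined by `i + j + k = 0` in `Fin 2`. -/
def vec : Factor → LocalVec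
  | ket l => SigmaStates.ket l
  | pair a b s => SigmaStates.pair a b s
  | quad a b c d i j => SigmaStates.quad a b c d i j (i + j)

/-- The integer coefficients of `√m` times a factor that is a sum of `m` terms. -/
def coeff : Factor → ℕ → ℤ
  | ket l => Pi.single l 1
  | pair a b s => Pi.single a 1 + Pi.single b ((-1) ^ (s : ℕ))
  | quad a b c d i j => Pi.single a 1 + Pi.single b ((-1) ^ (i : ℕ))
      + Pi.single c ((-1) ^ (j : ℕ)) + Pi.single d ((-1) ^ ((i + j : Fin 2) : ℕ))

/-- The number of basis vectors in a factor. -/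
def size : Factor → ℤ
  | ket _ => 1
  | pair .. => 2
  | quad .. => 4

/-- The integer coordinates of a factor at party `p`, up to normalization. -/
def coords (r : Factor) (p : Fin 3) (i : Fin (dims p)) : ℤ :=
  r.coeff (firstLabel p + i)

theorem vec_eq_smul_intVec (r : Factor) (p : Fin 3) :
    r.vec p = (((√r.size)⁻¹ : ℝ) : ℂ) • intVec (r.coords p) := by
  have sqrt_four : √(4 : ℝ) = 2 := by rw [Real.sqrt_eq_iff_mul_self_eq] <;> norm_num
  ext i
  cases r <;>
    simp [vec, coords, coeff, size, intVec, SigmaStates.ket, SigmaStates.pair, SigmaStates.quad,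
      sqrt_four, Pi.single_apply, mul_add]

theorem vec_eq_unitIntVec {r : Factor} {p : Fin 3} (h : r.coords p ⬝ᵥ r.coords p = r.size) :
    r.vec p = unitIntVec (r.coords p) := by
  rw [vec_eq_smul_intVec, unitIntVec, h]

/-- The local factors of the states of `Σ`. -/
def ofIndex : Index → Fin 3 → Factor
  | .inl (t, s) =>
    ![![ket 1, pair 1 2 s, ket 4],
      ![pair 1 2 s, ket 3, ket 4],
      ![ket 3, pair 2 3 s, ket 4],
      ![pair 2 3 s, ket 1, ket 4],
      ![ket 4, ket 3, pair 2 4 s],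
      ![pair 2 4 s, ket 3, ket 1],
      ![ket 1, ket 3, pair 1 2 s]] t
  | .inr (t, i, j) =>
    ![![ket 0, quad 0 1 2 3 i j, ket 3],
      ![quad 0 1 2 3 i j, ket 4, ket 3],
      ![ket 4, quad 1 2 3 4 i j, ket 3],
      ![quad 1 2 3 4 i j, ket 0, ket 3],
      ![ket 5, ket 0, quad 1 2 3 4 i j],
      ![quad 1 2 4 5 i j, ket 0, ket 5],
      ![ket 3, ket 0, quad 1 2 4 5 i j]] t

end Factor

/-- The state of `Σ` with a given label. -/
def state (t : Index) : StateVec fun p : Fin 3 => Fin (dims p) :=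
  tri (Factor.ofIndex t 0).vec (Factor.ofIndex t 1).vec (Factor.ofIndex t 2).vec

theorem exists_eq_state {ψ : StateVec fun p : Fin 3 => Fin (dims p)} (hψ : ψ ∈ SigmaSet) :
    ∃ t, ψ = state t := by
  obtain ⟨s, h⟩ | ⟨i, j, k, hk, h⟩ := hψ
  · obtain ⟨t, ht⟩ : ∃ t, ψ = state (.inl (t, s)) := by
      rcases h with h | h | h | h | h | h | h
      exacts [⟨0, h⟩, ⟨1, h⟩, ⟨2, h⟩, ⟨3, h⟩, ⟨4, h⟩, ⟨5, h⟩, ⟨6, h⟩]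
    exact ⟨_, ht⟩
  · obtain rfl : k = i + j := by clear h; decide +revert
    obtain ⟨t, ht⟩ : ∃ t, ψ = state (.inr (t, i, j)) := by
      rcases h with h | h | h | h | h | h | h
      exacts [⟨0, h⟩, ⟨1, h⟩, ⟨2, h⟩, ⟨3, h⟩, ⟨4, h⟩, ⟨5, h⟩, ⟨6, h⟩]
    exact ⟨_, ht⟩

theorem coords_dotProduct_self (t : Index) (p : Fin 3) :
    (Factor.ofIndex t p).coords p ⬝ᵥ (Factor.ofIndex t p).coords p = (Factor.ofIndex t p).size := by
  decide +kernel +revert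

theorem exists_coords_dotProduct_eq_zero {t u : Index} (h : t ≠ u) :
    ∃ p, (Factor.ofIndex t p).coords p ⬝ᵥ (Factor.ofIndex u p).coords p = 0 := by
  decide +kernel +revert

theorem coords_ne_zero (t : Index) (p : Fin 3) : (Factor.ofIndex t p).coords p ≠ 0 := by
  decide +kernel +revert

theorem state_eq_productVec_unitIntVec (t : Index) :
    state t = productVec fun p => unitIntVec ((Factor.ofIndex t p).coords p) :=
  congrArg productVec <| funext fun p => by
    rw [← Factor.vec_eq_unitIntVec (coords_dotProduct_self t p)]
    fin_cases p <;> rfl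

theorem norm_state (t : Index) : ‖state t‖ = 1 := by
  rw [state_eq_productVec_unitIntVec]
  exact norm_productVec_eq_one fun p => norm_unitIntVec (coords_ne_zero t p)

theorem inner_state_eq_zero {t u : Index} (h : t ≠ u) : inner ℂ (state t) (state u) = 0 := by
  obtain ⟨p, hp⟩ := exists_coords_dotProduct_eq_zero h
  rw [state_eq_productVec_unitIntVec, state_eq_productVec_unitIntVec, inner_productVec]
  exact Finset.prod_eq_zero (Finset.mem_univ p) <|
    (inner_unitIntVec_eq_zero_iff (coords_ne_zero t p) (coords_ne_zero u p)).2 hp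

theorem orthonormal_ket {κ : Type} {label : κ → ℕ} (hlabel : Injective label)
    {p : Fin 3} (hp : ∀ k, label k ∈ Set.Ico (firstLabel p) (firstLabel p + dims p)) :
    Orthonormal ℂ fun k => ket (label k) p := by
  choose i hi using fun k => Nat.exists_eq_add_of_le (hp k).1
  have basis (k : κ) : ket (label k) p
      = EuclideanSpace.single (⟨i k, by have := (hp k).2; grind⟩ : Fin (dims p)) (1 : ℂ) := by
    ext x
    simp [ket, hi, Fin.ext_iff]
  simp only [basis]
  refine EuclideanSpace.orthonormal_single.comp _ fun k l hkl => hlabel ?_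
  rw [hi, hi, Fin.mk.inj hkl]

/-- The tiles in the span of the basis vectors with three given labels. -/
def labelTile (label : Fin 3 → ℕ) (t : Fin 4) (s : Fin 2) : LocalVec :=
  ![ket (label 0), pair (label 0) (label 1) s, ket (label 2), pair (label 1) (label 2) s] t

theorem sum_tile_smul_ket (label : Fin 3 → ℕ) (t : Fin 4) (s : Fin 2) (p : Fin 3) :
    ∑ k, tile t s k • ket (label k) p = labelTile label t s p := by
  rw [sum_tile_smul fun k => ket (label k) p, labelTile]
  fin_cases t <;> rfl

theorem not_loccDistinguishable_of_labelTile {f : Fin 3 → Bool} {b : Fin 3} (hb : f b ≠ f 0)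
    {label : Fin 3 → ℕ} (hlabel : Injective label) (hrange : ∀ k, label k ∈ Set.Icc 1 4)
    {l : ℕ} (hl : l ∈ Set.Icc 1 4) {S : Set (StateVec fun p : Fin 3 => Fin (dims p))}
    (hS : ∀ t s, productVec (fun p => if p = 0 then labelTile label t s p else
      if p = b then labelTile label (t + 1) s p else ket l p) ∈ S) :
    ¬LOCCDistinguishable (groupParties f '' S) := by
  have common {m : ℕ} (hm : m ∈ Set.Icc 1 4) (p : Fin 3) :
      m ∈ Set.Ico (firstLabel p) (firstLabel p + dims p) := by
    have : firstLabel p ≤ 1 ∧ 4 < firstLabel p + dims p := by clear hS; decide +revert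
    exact ⟨this.1.trans hm.1, hm.2.trans_lt this.2⟩
  refine (locallyStable_domino (f 0)).not_loccDistinguishable_groupParties
    (g := fun q => if q = f 0 then 0 else b) (w := fun p k => ket (label k) p)
    (χ := fun p => ket l p) (fun q => ?_)
    (fun p => orthonormal_ket hlabel fun k => common (hrange k) p)
    (fun p => (orthonormal_ket (label := fun _ : Unit => l) (injective_of_subsingleton _)
      fun _ => common hl p).1 ()) fun ⟨t, s⟩ => ?_
  · split_ifs with hq
    · exact hq.symm
    · exact (Bool.eq_not_of_ne hb).trans (Bool.eq_not_of_ne hq).symm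
  · convert hS t s using 2
    funext p
    rw [withSpectators]
    by_cases h₀ : p = 0
    · subst h₀
      simp only [domino, if_true]
      exact sum_tile_smul_ket label t s 0
    by_cases h₁ : p = b
    · subst h₁
      simp only [domino, hb, h₀, if_true, if_false]
      exact sum_tile_smul_ket label (t + 1) s p
    · rw [if_neg h₀, if_neg h₁, if_neg]
      split_ifs <;> assumption

theorem productVec_eq_tri {φ : ∀ p, EuclideanSpace ℂ (Fin (dims p))} {a b c : LocalVec}
    (ha : φ 0 = a 0) (hb : φ 1 = b 1) (hc : φ 2 = c 2) : productVec φ = tri a b c :=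
  congrArg productVec (funext fun p => by fin_cases p <;> assumption)

theorem not_loccDistinguishable_of_bob₁ {f : Fin 3 → Bool} (hf : f 1 ≠ f 0) :
    ¬LOCCDistinguishable (groupParties f '' SigmaSet) := by
  refine not_loccDistinguishable_of_labelTile hf (label := ![1, 2, 3]) (l := 4) (by decide)
    (by decide) (by decide) fun t s => Or.inl ⟨s, ?_⟩
  fin_cases t
  · exact Or.inl (productVec_eq_tri rfl rfl rfl)
  · exact Or.inr (Or.inl (productVec_eq_tri rfl rfl rfl))
  · exact Or.inr (Or.inr (Or.inl (productVec_eq_tri rfl rfl rfl)))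
  · exact Or.inr (Or.inr (Or.inr (Or.inl (productVec_eq_tri rfl rfl rfl))))

theorem not_loccDistinguishable_of_bob₂ {f : Fin 3 → Bool} (hf : f 2 ≠ f 0) :
    ¬LOCCDistinguishable (groupParties f '' SigmaSet) := by
  refine not_loccDistinguishable_of_labelTile hf (label := ![1, 2, 4]) (l := 3) (by decide)
    (by decide) (by decide) fun t s => Or.inl ⟨s, ?_⟩
  fin_cases t
  · exact Or.inr (Or.inr (Or.inr (Or.inr (Or.inr (Or.inr (productVec_eq_tri rfl rfl rfl))))))
  · exact Or.inr (Or.inl (productVec_eq_tri rfl rfl rfl))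
  · exact Or.inr (Or.inr (Or.inr (Or.inr (Or.inl (productVec_eq_tri rfl rfl rfl)))))
  · exact Or.inr (Or.inr (Or.inr (Or.inr (Or.inr (Or.inl (productVec_eq_tri rfl rfl rfl))))))

theorem exists_eq_productVec {ψ : StateVec fun p : Fin 3 => Fin (dims p)} (hψ : ψ ∈ SigmaSet) :
    ∃ φ : ∀ p, EuclideanSpace ℂ (Fin (dims p)), ψ = productVec φ := by
  obtain ⟨t, rfl⟩ := exists_eq_state hψ
  exact ⟨_, rfl⟩

end SigmaStates

end

theorem proposition4 : IsGNPS SigmaStates.SigmaSet := by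
  refine ⟨fun ψ hψ => ?_, fun ψ hψ => SigmaStates.exists_eq_productVec hψ,
    fun ψ hψ φ hφ hne => ?_, fun f hf => ?_⟩
  · obtain ⟨t, rfl⟩ := SigmaStates.exists_eq_state hψ
    exact SigmaStates.norm_state t
  · obtain ⟨t, rfl⟩ := SigmaStates.exists_eq_state hψ
    obtain ⟨u, rfl⟩ := SigmaStates.exists_eq_state hφ
    exact SigmaStates.inner_state_eq_zero fun h => hne (congrArg _ h)
  · by_cases bob₁ : f 1 = f 0
    · refine SigmaStates.not_loccDistinguishable_of_bob₂ fun bob₂ => ?_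
      obtain ⟨i, hi⟩ := hf (!f 0)
      fin_cases i <;> simp_all
    · exact SigmaStates.not_loccDistinguishable_of_bob₁ bob₁
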